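/- Let $G$ be a finitely generated virtually free group, that is, a finitely generated group with a finite index subgroup isomorphic to a free group, and let $k>1$ be an integer. Then the $k$-SAT problem over $G$ is decidable: for every finite generating set $S$ of $G$ there is an algorithm that solves the following decision problem. Input: a formula $$\phi=\bigwedge_{i=1}^m\left(v_{i1}'\vee\dots\vee v_{ik}'\right),$$ where each $v_{ij}$ is a word over $S\cup S^{-1}$ and $v_{ij}'$ denotes either $v_{ij}$ or its negation $\neg v_{ij}$, together with a finite list $w_1,\dots,w_n$ of words over $S\cup S^{-1}$. Question: write $\bar v\in G$ for the element represented by a word $v$, and let $H=\langle \bar w_1,\dots,\bar w_n\rangle\le G$. Is the formula $$\bigwedge_{h\in H}\ \bigwedge_{i=1}^m\left((h\bar v_{i1})'\vee\dots\vee (h\bar v_{ik})'\right),$$ with the elements of $G$ as variables and each literal keeping the sign it has in $\phi$, satisfiable; that is, is there an assignment $\alpha:G\to\{0,1\}$ that makes every clause true? -/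

import Mathlib

/-- A group is virtually free if it has a finite index subgroup that is a free group
(of any rank, rank zero included). -/
def IsVirtuallyFree (G : Type*) [Group G] : Prop :=
  ∃ F : Subgroup G, F.FiniteIndex ∧ IsFreeGroup F

namespace GroupSAT

/-- Words over `S ∪ S⁻¹`, where `S` is enumerated by `Fin d`: the letter `(i, true)` stands for
the `i`-th generator and `(i, false)` for its inverse. -/
abbrev Word (d : ℕ) : Type := List (Fin d × Bool)

/-- The element of `G` that a word represents. -/
def Word.eval {G : Type*} [Group G] {d : ℕ} (s : Fin d → G) (w : Word d) : G :=
  (w.map fun l => if l.2 then s l.1 else (s l.1)⁻¹).prod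

/-- Literals with variables in `V`: `(true, v)` is `v` and `(false, v)` is `¬ v`. -/
abbrev Literal (V : Type*) : Type _ := Bool × V

/-- Formulas in conjunctive normal form with variables in `V` and `k` literals in each clause:
a finite list of clauses, read as their conjunction. -/
abbrev Formula (k : ℕ) (V : Type*) : Type _ := List (Fin k → Literal V)

/-- Replace every variable `v` of a formula by `f v`, keeping the signs of the literals. -/
def Formula.mapVar {k : ℕ} {V W : Type*} (f : V → W) (φ : Formula k V) : Formula k W :=
  φ.map fun c j => ((c j).1, f (c j).2)

/-- The truth value that an assignment gives to a literal. -/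
def Literal.value {V : Type*} (α : V → Bool) (l : Literal V) : Bool :=
  if l.1 then α l.2 else !(α l.2)

/-- The assignment `α` makes the formula true: every clause has a true literal. -/
def Formula.Holds {k : ℕ} {V : Type*} (α : V → Bool) (φ : Formula k V) : Prop :=
  ∀ c ∈ φ, ∃ j, Literal.value α (c j) = true

/-- The infinite formula `⋀_{h ∈ H} φ(h)` is satisfiable, where `φ(h)` is `φ` with every variable
multiplied by `h` on the left. -/
def Formula.SatisfiableOver {G : Type*} [Group G] {k : ℕ} (H : Subgroup G)
    (φ : Formula k G) : Prop :=
  ∃ α : G → Bool, ∀ h ∈ H, (φ.mapVar (fun g => h * g)).Holds α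

/-- Inputs of the `k`-SAT problem: a formula whose variables are words, and a finite list of
words that specifies the generators of a subgroup. -/
abbrev Input (d k : ℕ) : Type := Formula k (Word d) × List (Word d)

/-- The subgroup generated by the elements that the words of the list represent. -/
def generated {G : Type*} [Group G] {d : ℕ} (s : Fin d → G) (ws : List (Word d)) : Subgroup G :=
  Subgroup.closure {g | ∃ w ∈ ws, w.eval s = g}

/-- The yes-instances of the `k`-SAT problem over `G` with respect to the generators `s`. -/
def KSAT {G : Type*} [Group G] {d : ℕ} (s : Fin d → G) (k : ℕ) (p : Input d k) : Prop :=
  Formula.SatisfiableOver (generated s p.2) (p.1.mapVar (Word.eval s))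

/-- The `k`-SAT problem over `G` is decidable: for each finite enumerated generating set of `G`
there is an algorithm that decides it. -/
def KSATDecidable (k : ℕ) (G : Type*) [Group G] : Prop :=
  ∀ (d : ℕ) (s : Fin d → G), Subgroup.closure (Set.range s) = ⊤ →
    ComputablePred (KSAT s k)

end GroupSAT

/-!
Let `F` be a free subgroup of finite index in `G`, of finite rank by Schreier's lemma, and let `T`
be a finite right transversal of `F` with `1 ∈ T`.

*Local form of the subgroup.* The formula is satisfiable over `H = ⟨w₁, …, wₙ⟩` if and only if there
are `α χ : G → Bool` such that `χ 1` is true, `χ g = χ (g wⱼ)` for all `g : G`, and the translate of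
the formula by `g` is true under `α` for every `g` with `χ g` (`kSAT_iff_exists_marking`). The
subgroup has thus become part of a system of clauses that holds at all `g : G`, apart from the one
condition at `1`; no membership problem for `H` has to be solved.

*Passage to the tree.* As `G = F · T`, such a pair `(α, χ)` is an assignment on `F × (T × Bool)`, and
the conditions are the `F`-translates of finitely many clauses. They are computed from the input by
the finite transducer that rewrites a word over the generators, read from a coset `F t`, as a word
over the basis of `F` and a new coset (`Table.Computes.run`, `kSAT_iff_treeSat`).

*Decision over a free group.* Since the Cayley graph of `F` is a tree, a solution exists if and only
if there is a finite set of local patterns, satisfying the clauses, one of them with the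
seed, in which each pattern has a compatible neighbour in every direction (`treeSat_iff`): given
such a set, a solution is built along the reduced words. The patterns live on a finite window
computed from the clauses, so the search is bounded and the problem is primitive recursive
(`primrecPred_treeSat`).
-/

/-! ### Clauses on the Cayley tree of a free group -/

namespace GroupSAT

/-- Variables placed on the vertices of the Cayley tree of `FreeGroup ι`, with a colour in `C`.
`(x, c)` is the variable of colour `c` at the vertex represented by `x`; the word `x` need not be
reduced, and variables are compared as words. -/
abbrev TreeVar (ι C : Type*) : Type _ := List (ι × Bool) × C

/-- A list of clauses; the literal `(b, v)` asks that `v` have the value `b`. -/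
abbrev TreeFormula (ι C : Type*) : Type _ := List (List (Bool × TreeVar ι C))

section Tree

variable {ι C : Type*}

/-- Some assignment on `FreeGroup ι × C` is true at `(1, c₀)` and satisfies every left translate
of every clause of `Φ`. -/
def TreeSat (c₀ : C) (Φ : TreeFormula ι C) : Prop :=
  ∃ β : FreeGroup ι → C → Bool, β 1 c₀ = true ∧
    ∀ f, ∀ cl ∈ Φ, ∃ l ∈ cl, β (f * FreeGroup.mk l.2.1) l.2.2 = l.1

/-- The formal inverse of a letter. -/
def letterInv (a : ι × Bool) : ι × Bool := (a.1, !a.2)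

@[simp]
theorem letterInv_letterInv (a : ι × Bool) : letterInv (letterInv a) = a := by
  simp [letterInv]

/-- The variables that a local pattern records: `([], c₀)` and, for each literal `(b, (x, c))`,
all `(y, c)` with `y` a suffix of `x`. -/
def window (c₀ : C) (Φ : TreeFormula ι C) : List (TreeVar ι C) :=
  ([], c₀) :: Φ.flatten.flatMap fun l =>
    (List.range (l.2.1.length + 1)).map fun n => (l.2.1.drop n, l.2.2)

theorem nil_mem_window (c₀ : C) (Φ : TreeFormula ι C) : ([], c₀) ∈ window c₀ Φ := by
  simp [window]

theorem mem_window_of_mem {c₀ : C} {Φ : TreeFormula ι C} {cl : List (Bool × TreeVar ι C)}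
    (hcl : cl ∈ Φ) {l : Bool × TreeVar ι C} (hl : l ∈ cl) : l.2 ∈ window c₀ Φ := by
  refine List.mem_cons_of_mem _ (List.mem_flatMap.2 ⟨l, List.mem_flatten.2 ⟨cl, hcl, hl⟩, ?_⟩)
  exact List.mem_map.2 ⟨0, by simp⟩

theorem mem_window_of_cons_mem {c₀ : C} {Φ : TreeFormula ι C} {a : ι × Bool}
    {x : List (ι × Bool)} {c : C} (h : (a :: x, c) ∈ window c₀ Φ) : (x, c) ∈ window c₀ Φ := by
  simp only [window, List.mem_cons, Prod.mk.injEq, reduceCtorEq, false_and, List.mem_flatMap,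
    List.mem_map, List.mem_range, false_or] at h ⊢
  obtain ⟨l, hl, n, hn, hx, rfl⟩ := h
  have hlen : n < l.2.1.length := by
    by_contra hlt
    rw [List.drop_eq_nil_of_le (by omega)] at hx
    cases hx
  refine Or.inr ⟨l, hl, n + 1, by omega, ?_, rfl⟩
  rw [← List.tail_drop, hx, List.tail_cons]

/-- The patterns `p` at a vertex `f` and `q` at the neighbour `f * a` give the same values to the
variables of the window `U` that they share. A pattern is the list of its true variables, addressed
relative to its vertex: what `q` calls `(x, c)` is `(a :: x, c)` for `p`, and what `p` calls `(x, c)`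
is `(a⁻¹ :: x, c)` for `q`. Both are required, as addresses are not reduced. -/
def Compat (U : List (TreeVar ι C)) (a : ι × Bool) (p q : List (TreeVar ι C)) : Prop :=
  ∀ v ∈ U, ((a :: v.1, v.2) ∈ U → ((a :: v.1, v.2) ∈ p ↔ v ∈ q)) ∧
    ((letterInv a :: v.1, v.2) ∈ U → ((letterInv a :: v.1, v.2) ∈ q ↔ v ∈ p))

theorem Compat.symm {U : List (TreeVar ι C)} {a : ι × Bool} {p q : List (TreeVar ι C)}
    (h : Compat U a p q) : Compat U (letterInv a) q p := fun v hv => by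
  rw [letterInv_letterInv]
  exact (h v hv).symm

/-- A finite set `P` of local patterns from which a solution can be built along the tree: one of
them is true at the seed, each satisfies the clauses at its own vertex, and each has, in every
direction `a`, a compatible neighbour in `P`. -/
structure IsCertificate [Fintype ι] (c₀ : C) (Φ : TreeFormula ι C)
    (P : List (List (TreeVar ι C))) : Prop where
  seed : ∃ p ∈ P, ([], c₀) ∈ p
  holds : ∀ p ∈ P, ∀ cl ∈ Φ, ∃ l ∈ cl, (l.1 = true ↔ l.2 ∈ p)
  extend : ∀ p ∈ P, ∀ a ∈ (Finset.univ : Finset (ι × Bool)).toList, ∃ q ∈ P,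
    Compat (window c₀ Φ) a p q

/-- A relation on labels that can be extended from any label in any direction is realized by a
labelling of the whole Cayley graph of a free group, because this graph is a tree. -/
theorem exists_walk [DecidableEq ι] {X : Type*} {R : ι × Bool → X → X → Prop}
    (hsymm : ∀ a x y, R a x y → R (letterInv a) y x) (hext : ∀ x a, ∃ y, R a x y) (x₀ : X) :
    ∃ P : FreeGroup ι → X, P 1 = x₀ ∧ ∀ f a, R a (P f) (P (f * FreeGroup.mk [a])) := by
  choose step hstep using hext
  -- `P f` is reached along the reduced word of `f`, which is read off `f⁻¹` from its end.
  let run : List (ι × Bool) → X := fun L => L.foldr (fun b x => step x (letterInv b)) x₀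
  refine ⟨fun f => run f⁻¹.toWord, by simp [run], fun f a => ?_⟩
  have hw : (f * FreeGroup.mk [a])⁻¹ = FreeGroup.mk (letterInv a :: f⁻¹.toWord) := by
    rw [mul_inv_rev, FreeGroup.inv_mk, ← List.singleton_append (x := letterInv a),
      ← FreeGroup.mul_mk, FreeGroup.mk_toWord]
    rfl
  have hred : FreeGroup.reduce f⁻¹.toWord = f⁻¹.toWord := FreeGroup.reduce_toWord _
  simp only [hw, FreeGroup.toWord_mk, FreeGroup.reduce.cons, hred]
  rcases hL : f⁻¹.toWord with _ | ⟨b, L⟩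
  · simpa [run] using hstep x₀ a
  -- Multiplication by `a` either cancels the last letter of the reduced word of `f`, and then the
  -- symmetry of `R` applies to the step that produced it, or appends a letter.
  · dsimp only
    split_ifs with hab
    · have hb : b = a := by
        rcases a with ⟨i, u⟩; rcases b with ⟨j, w⟩
        simp only [letterInv, Bool.not_eq_eq_eq_not, Bool.not_not] at hab
        rw [hab.1, hab.2]
      subst hb
      simpa [run] using hsymm _ _ _ (hstep (run L) (letterInv b))
    · simpa [run] using hstep (run (b :: L)) a

theorem TreeSat.of_isCertificate [Fintype ι] {c₀ : C} {Φ : TreeFormula ι C}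
    {P : List (List (TreeVar ι C))} (hP : IsCertificate c₀ Φ P) : TreeSat c₀ Φ := by
  classical
  obtain ⟨p₀, hp₀, hseed⟩ := hP.seed
  obtain ⟨Q, hQ₁, hQ⟩ := exists_walk (X := {p // p ∈ P})
    (R := fun a p q => Compat (window c₀ Φ) a p.1 q.1) (fun _ _ _ h => h.symm)
    (fun p a => by
      obtain ⟨q, hq, h⟩ := hP.extend p.1 p.2 a (by simp)
      exact ⟨⟨q, hq⟩, h⟩) ⟨p₀, hp₀⟩
  -- What the pattern at `f` says about `f * x` is what the pattern at `f * x` says about itself: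
  -- move along `x` one letter at a time, staying in the window since it is closed under suffixes.
  have key : ∀ (x : List (ι × Bool)) (c : C), (x, c) ∈ window c₀ Φ → ∀ f,
      (x, c) ∈ (Q f).1 ↔ ([], c) ∈ (Q (f * FreeGroup.mk x)).1 := by
    intro x c
    induction x with
    | nil => intro _ f; rw [← FreeGroup.one_eq_mk, mul_one]
    | cons a x ih =>
      intro hx f
      have hx' := mem_window_of_cons_mem hx
      rw [((hQ f a) (x, c) hx').1 hx, ih hx', mul_assoc, FreeGroup.mul_mk, List.singleton_append]
  refine ⟨fun f c => decide (([], c) ∈ (Q f).1), by simpa [hQ₁] using hseed, fun f cl hcl => ?_⟩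
  obtain ⟨l, hl, h⟩ := hP.holds _ (Q f).2 cl hcl
  refine ⟨l, hl, ?_⟩
  have hk := key l.2.1 l.2.2 (mem_window_of_mem hcl hl) f
  rw [Bool.eq_iff_iff, decide_eq_true_iff, ← hk, h]

/-- The patterns that occur in a solution form a certificate. -/
theorem TreeSat.exists_isCertificate [Fintype ι] {c₀ : C} {Φ : TreeFormula ι C}
    (h : TreeSat c₀ Φ) : ∃ P ∈ (window c₀ Φ).sublists.sublists, IsCertificate c₀ Φ P := by
  classical
  obtain ⟨β, hβ₁, hβ⟩ := h
  set U := window c₀ Φ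
  let pat : FreeGroup ι → List (TreeVar ι C) := fun f =>
    U.filter fun v => β (f * FreeGroup.mk v.1) v.2
  have hpat : ∀ f v, v ∈ U → (v ∈ pat f ↔ β (f * FreeGroup.mk v.1) v.2 = true) := by
    intro f v hv; simp [pat, hv]
  refine ⟨U.sublists.filter fun p => decide (∃ f, pat f = p),
    List.mem_sublists.2 List.filter_sublist, ?_⟩
  have hmem : ∀ p, p ∈ (U.sublists.filter fun p => decide (∃ f, pat f = p)) ↔ ∃ f, pat f = p := by
    intro p
    rw [List.mem_filter, decide_eq_true_iff, and_iff_right_iff_imp]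
    rintro ⟨f, rfl⟩
    exact List.mem_sublists.2 List.filter_sublist
  refine ⟨⟨pat 1, (hmem _).2 ⟨1, rfl⟩, ?_⟩, ?_, ?_⟩
  · rw [hpat _ _ (nil_mem_window _ _), ← FreeGroup.one_eq_mk, mul_one, hβ₁]
  · intro p hp cl hcl
    obtain ⟨f, rfl⟩ := (hmem p).1 hp
    obtain ⟨l, hl, h⟩ := hβ f cl hcl
    exact ⟨l, hl, by rw [hpat _ _ (mem_window_of_mem hcl hl), h]⟩
  · intro p hp a _
    obtain ⟨f, rfl⟩ := (hmem p).1 hp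
    refine ⟨pat (f * FreeGroup.mk [a]), (hmem _).2 ⟨_, rfl⟩, fun v hv => ⟨fun h => ?_, fun h => ?_⟩⟩
    · rw [hpat _ _ h, hpat _ _ hv, mul_assoc, FreeGroup.mul_mk, List.singleton_append]
    · have hc : FreeGroup.mk [a] * FreeGroup.mk (letterInv a :: v.1) = FreeGroup.mk v.1 := by
        rw [FreeGroup.mul_mk, List.singleton_append]
        exact Quot.sound (FreeGroup.Red.Step.cons_not (x := a.1) (b := a.2))
      rw [hpat _ _ h, hpat _ _ hv, mul_assoc, hc]

theorem treeSat_iff [Fintype ι] {c₀ : C} {Φ : TreeFormula ι C} :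
    TreeSat c₀ Φ ↔ ∃ P ∈ (window c₀ Φ).sublists.sublists, IsCertificate c₀ Φ P :=
  ⟨TreeSat.exists_isCertificate, fun ⟨_, _, h⟩ => .of_isCertificate h⟩

end Tree

end GroupSAT

/-! ### The certificate search is primitive recursive -/

namespace GroupSAT

section Primitive

variable {α β ι C : Type*} [Primcodable α] [Primcodable β]

theorem _root_.PrimrecPred.imp {p q : α → Prop} (hp : PrimrecPred p) (hq : PrimrecPred q) :
    PrimrecPred fun a => p a → q a :=
  (hp.not.or hq).of_eq fun _ => by tauto

theorem _root_.PrimrecPred.iff {p q : α → Prop} (hp : PrimrecPred p) (hq : PrimrecPred q) :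
    PrimrecPred fun a => (p a ↔ q a) :=
  ((hp.imp hq).and (hq.imp hp)).of_eq fun _ => by tauto

theorem _root_.PrimrecPred.exists_mem {f : α → List β} {R : α → β → Prop} (hf : Primrec f)
    (hR : PrimrecRel R) : PrimrecPred fun a => ∃ b ∈ f a, R a b :=
  (PrimrecRel.exists_mem_list (R := fun b a => R a b) (hR.comp .snd .fst)).comp hf .id

theorem _root_.PrimrecPred.forall_mem {f : α → List β} {R : α → β → Prop} (hf : Primrec f)
    (hR : PrimrecRel R) : PrimrecPred fun a => ∀ b ∈ f a, R a b :=
  (PrimrecRel.forall_mem_list (R := fun b a => R a b) (hR.comp .snd .fst)).comp hf .id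

theorem _root_.PrimrecPred.mem_list {f : α → β} {g : α → List β} (hf : Primrec f)
    (hg : Primrec g) : PrimrecPred fun a => f a ∈ g a :=
  (PrimrecPred.exists_mem (R := fun a b => b = f a) hg
    (Primrec.eq.comp .snd (hf.comp .fst))).of_eq fun _ => by simp

theorem _root_.Primrec.list_sublists : Primrec (List.sublists : List α → List (List α)) := by
  have hpair : Primrec₂ fun (t : List α × α × List (List α)) (x : List α) => [x, t.2.1 :: x] :=
    Primrec.list_cons.comp .snd (Primrec.list_cons.comp
      (Primrec.list_cons.comp (Primrec.fst.comp (Primrec.snd.comp .fst)) .snd) (.const []))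
  have hstep : Primrec₂ fun (_ : List α) (t : α × List (List α)) =>
      t.2.flatMap fun x => [x, t.1 :: x] :=
    Primrec.list_flatMap (Primrec.snd.comp .snd) hpair
  exact Primrec.list_foldr .id (.const [[]]) hstep

variable [Primcodable ι] [Primcodable C]

theorem primrec_window (c₀ : C) : Primrec (window c₀ : TreeFormula ι C → List (TreeVar ι C)) := by
  have hmap : Primrec₂ fun (_ : TreeFormula ι C) (l : Bool × TreeVar ι C) =>
      (List.range (l.2.1.length + 1)).map fun n => (l.2.1.drop n, l.2.2) := by
    refine Primrec.list_map (Primrec.list_range.comp (Primrec.succ.comp (Primrec.list_length.comp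
      (Primrec.fst.comp (Primrec.snd.comp .snd))))) ?_
    have hl : Primrec fun t : (TreeFormula ι C × Bool × TreeVar ι C) × ℕ => t.1.2.2 :=
      Primrec.snd.comp (Primrec.snd.comp .fst)
    exact Primrec.pair (Primrec.list_drop.comp .snd (Primrec.fst.comp hl)) (Primrec.snd.comp hl)
  exact Primrec.list_cons.comp (.const _) (Primrec.list_flatMap Primrec.list_flatten hmap)

theorem primrecPred_compat [Finite ι] {U p q : α → List (TreeVar ι C)} {a : α → ι × Bool}
    (hU : Primrec U) (ha : Primrec a) (hp : Primrec p) (hq : Primrec q) :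
    PrimrecPred fun t => Compat (U t) (a t) (p t) (q t) := by
  have hinv : Primrec fun t => letterInv (a t) := (Primrec.dom_finite letterInv).comp ha
  have hcons : ∀ {b : α → ι × Bool}, Primrec b → Primrec fun t : α × TreeVar ι C =>
      ((b t.1 :: t.2.1, t.2.2) : TreeVar ι C) := fun hb =>
    .pair (Primrec.list_cons.comp (hb.comp .fst) (Primrec.fst.comp .snd)) (Primrec.snd.comp .snd)
  exact PrimrecPred.forall_mem hU (PrimrecPred.and
    ((PrimrecPred.mem_list (hcons ha) (hU.comp .fst)).imp
      ((PrimrecPred.mem_list (hcons ha) (hp.comp .fst)).iff (.mem_list .snd (hq.comp .fst))))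
    ((PrimrecPred.mem_list (hcons hinv) (hU.comp .fst)).imp
      ((PrimrecPred.mem_list (hcons hinv) (hq.comp .fst)).iff (.mem_list .snd (hp.comp .fst)))))

theorem primrecRel_isCertificate [Fintype ι] (c₀ : C) :
    PrimrecRel (IsCertificate c₀ : TreeFormula ι C → List (List (TreeVar ι C)) → Prop) := by
  have hseed : PrimrecPred fun t : TreeFormula ι C × List (List (TreeVar ι C)) =>
      ∃ p ∈ t.2, ([], c₀) ∈ p :=
    .exists_mem .snd (.mem_list (.const _) .snd)
  have hholds : PrimrecPred fun t : TreeFormula ι C × List (List (TreeVar ι C)) =>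
      ∀ p ∈ t.2, ∀ cl ∈ t.1, ∃ l ∈ cl, (l.1 = true ↔ l.2 ∈ p) :=
    .forall_mem .snd (.forall_mem (Primrec.fst.comp .fst) (.exists_mem .snd
      ((Primrec.eq.comp (Primrec.fst.comp .snd) (.const true)).iff
        (.mem_list (Primrec.snd.comp .snd) (Primrec.snd.comp (Primrec.fst.comp .fst))))))
  have hext : PrimrecPred fun t : TreeFormula ι C × List (List (TreeVar ι C)) =>
      ∀ p ∈ t.2, ∀ a ∈ (Finset.univ : Finset (ι × Bool)).toList, ∃ q ∈ t.2,
        Compat (window c₀ t.1) a p q :=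
    .forall_mem .snd (.forall_mem (.const _) (.exists_mem
      (Primrec.snd.comp (Primrec.fst.comp .fst))
      (primrecPred_compat
        ((primrec_window c₀).comp (Primrec.fst.comp (Primrec.fst.comp (Primrec.fst.comp .fst))))
        (Primrec.snd.comp .fst) (Primrec.snd.comp (Primrec.fst.comp .fst)) .snd)))
  exact ((hseed.and hholds).and hext).of_eq fun _ =>
    ⟨fun h => ⟨h.1.1, h.1.2, h.2⟩, fun h => ⟨⟨h.seed, h.holds⟩, h.extend⟩⟩

/-- Since the certificates can be searched among the sets of subsets of the window, satisfiability
over the tree is primitive recursive. -/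
theorem primrecPred_treeSat [Finite ι] (c₀ : C) :
    PrimrecPred (TreeSat c₀ : TreeFormula ι C → Prop) := by
  have := Fintype.ofFinite ι
  exact (PrimrecPred.exists_mem (Primrec.list_sublists.comp (Primrec.list_sublists.comp
    (primrec_window c₀))) (primrecRel_isCertificate c₀)).of_eq fun _ => treeSat_iff.symm

end Primitive

end GroupSAT

/-! ### Virtually free groups as products -/

namespace GroupSAT

/-- A finitely generated group has finitely many homomorphisms to `ℤ/2`, whereas those of
`FreeGroup ι` correspond to the maps `ι → ℤ/2`. -/
theorem finite_of_fg_freeGroup {ι : Type*} (h : Group.FG (FreeGroup ι)) : Finite ι := by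
  classical
  obtain ⟨S, hS⟩ := h.1
  let B := Multiplicative (ZMod 2)
  have : Finite (ι → B) := by
    refine Finite.of_injective (β := S → B) (fun u x => FreeGroup.lift u x) fun u v huv => ?_
    refine FreeGroup.lift.injective (MonoidHom.eq_of_eqOn_dense hS fun x hx => ?_)
    exact congrFun huv ⟨x, hx⟩
  refine Finite.of_injective (β := ι → B) (fun i => Pi.mulSingle i (Multiplicative.ofAdd 1)) ?_
  intro i j hij
  by_contra hne
  have := congrFun hij i
  simp only [Pi.mulSingle_eq_same, Pi.mulSingle_eq_of_ne hne] at this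
  exact absurd this (by decide)

/-- `G` is the product of a free group of finite rank and a finite right transversal that
contains `1`. -/
theorem exists_free_transversal {G : Type*} [Group G] (hfg : Group.FG G) (hG : IsVirtuallyFree G) :
    ∃ (r m : ℕ) (f : FreeGroup (Fin r) →* G) (t : Fin m → G) (i₀ : Fin m), t i₀ = 1 ∧
      Function.Bijective fun x : FreeGroup (Fin r) × Fin m => f x.1 * t x.2 := by
  obtain ⟨F, hF, hfree⟩ := hG
  obtain ⟨ι, ⟨b⟩⟩ := hfree.nonempty_basis
  have hFG : Group.FG F := inferInstance
  have : Finite ι := finite_of_fg_freeGroup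
    (Group.fg_of_surjective (f := b.repr.toMonoidHom) b.repr.surjective)
  obtain ⟨r, ⟨e⟩⟩ := Finite.exists_equiv_fin ι
  let e' : FreeGroup (Fin r) ≃* F := (b.reindex e).repr.symm
  obtain ⟨T, hT, h1⟩ := F.exists_isComplement_right 1
  have : Finite T := hT.finite_right
  obtain ⟨m, ⟨u⟩⟩ := Finite.exists_equiv_fin T
  refine ⟨r, m, F.subtype.comp e'.toMonoidHom, fun i => u.symm i, u ⟨1, h1⟩, by simp, ?_⟩
  exact Function.Bijective.comp hT (e'.toEquiv.prodCongr u.symm).bijective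

/-! ### Rewriting words by a finite transducer -/

section Transducer

variable {r m d : ℕ}

/-- The transition table of a transducer with states `Fin m`, which reads letters over `d`
generators and writes words over `r` generators. -/
abbrev Table (r m d : ℕ) : Type := Fin m × Fin d × Bool → List (Fin r × Bool) × Fin m

/-- The output word and the final state when the transducer reads `w` from the state `i`. -/
def Table.run (τ : Table r m d) (i : Fin m) (w : Word d) : List (Fin r × Bool) × Fin m :=
  w.foldl (fun x l => (x.1 ++ (τ (x.2, l)).1, (τ (x.2, l)).2)) ([], i)

theorem Table.primrec_run (τ : Table r m d) : Primrec₂ τ.run := by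
  have hτ : Primrec fun t : (Fin m × Word d) × (List (Fin r × Bool) × Fin m) × Fin d × Bool =>
      τ (t.2.1.2, t.2.2) :=
    (Primrec.dom_finite τ).comp (.pair (Primrec.snd.comp (Primrec.fst.comp .snd))
      (Primrec.snd.comp .snd))
  have hstep : Primrec₂ fun (_ : Fin m × Word d)
      (t : (List (Fin r × Bool) × Fin m) × Fin d × Bool) =>
      (t.1.1 ++ (τ (t.1.2, t.2)).1, (τ (t.1.2, t.2)).2) :=
    Primrec.pair (Primrec.list_append.comp (Primrec.fst.comp (Primrec.fst.comp .snd))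
      (Primrec.fst.comp hτ)) (Primrec.snd.comp hτ)
  exact Primrec.list_foldl .snd (.pair (.const []) .fst) hstep

variable {G : Type*} [Group G]

/-- The table records right multiplication by letters on the product `F · T`:
`tᵢ · l = f(x) · tⱼ` where `(x, j) = τ (i, l)`. -/
def Table.Computes (τ : Table r m d) (f : FreeGroup (Fin r) →* G) (t : Fin m → G)
    (s : Fin d → G) : Prop :=
  ∀ i l, t i * (if l.2 then s l.1 else (s l.1)⁻¹) = f (FreeGroup.mk (τ (i, l)).1) * t (τ (i, l)).2

theorem Table.exists_computes {f : FreeGroup (Fin r) →* G} {t : Fin m → G}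
    (h : Function.Surjective fun x : FreeGroup (Fin r) × Fin m => f x.1 * t x.2)
    (s : Fin d → G) : ∃ τ : Table r m d, τ.Computes f t s := by
  choose q hq using h
  let g : Fin m × Fin d × Bool → G := fun p => t p.1 * if p.2.2 then s p.2.1 else (s p.2.1)⁻¹
  exact ⟨fun p => ((q (g p)).1.toWord, (q (g p)).2), fun i l => by
    rw [FreeGroup.mk_toWord]; exact (hq (g (i, l))).symm⟩

theorem Table.Computes.run {τ : Table r m d} {f : FreeGroup (Fin r) →* G} {t : Fin m → G}
    {s : Fin d → G} (h : τ.Computes f t s) (i : Fin m) (w : Word d) :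
    f (FreeGroup.mk (τ.run i w).1) * t (τ.run i w).2 = t i * w.eval s := by
  have key : ∀ (w : Word d) (x : List (Fin r × Bool)) (i : Fin m),
      (fun y : List (Fin r × Bool) × Fin m => f (FreeGroup.mk y.1) * t y.2)
        (w.foldl (fun x l => (x.1 ++ (τ (x.2, l)).1, (τ (x.2, l)).2)) (x, i)) =
      f (FreeGroup.mk x) * (t i * w.eval s) := by
    intro w
    induction w with
    | nil => intro x i; simp [Word.eval]
    | cons l w ih =>
      intro x i
      rw [List.foldl_cons, ih, ← FreeGroup.mul_mk, map_mul, mul_assoc,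
        ← mul_assoc (f (FreeGroup.mk (τ (i, l)).1)), ← h i l, mul_assoc (t i)]
      rfl
  simpa [← FreeGroup.one_eq_mk, Table.run] using key w [] i

end Transducer

/-! ### Reduction of the `k`-SAT problem to the tree -/

section Encoding

variable {r m d k : ℕ}

/-- The marking agrees at `g` and at `g * w`, for `g` in the coset `F tᵢ`. Colour `(i, true)` at
`x` is the marking of `x tᵢ`, colour `(i, false)` is its truth value. -/
def closureClauses (τ : Table r m d) (i : Fin m) (w : Word d) :
    TreeFormula (Fin r) (Fin m × Bool) :=
  [[(false, ([], (i, true))), (true, ((τ.run i w).1, ((τ.run i w).2, true)))],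
   [(false, ((τ.run i w).1, ((τ.run i w).2, true))), (true, ([], (i, true)))]]

/-- If `g`, in the coset `F tᵢ`, is marked, then the translate of the clause `c` by `g` is true. -/
def guardedClause (τ : Table r m d) (i : Fin m) (c : Fin k → Literal (Word d)) :
    List (Bool × TreeVar (Fin r) (Fin m × Bool)) :=
  (false, ([], (i, true))) :: List.ofFn fun j =>
    ((c j).1, ((τ.run i (c j).2).1, ((τ.run i (c j).2).2, false)))

/-- The clauses on the tree that express an input of the `k`-SAT problem. -/
def treeFormula (τ : Table r m d) (p : Input d k) : TreeFormula (Fin r) (Fin m × Bool) :=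
  (List.finRange m).flatMap fun i =>
    p.2.flatMap (closureClauses τ i) ++ p.1.map (guardedClause τ i)

theorem primrec_treeFormula (τ : Table r m d) :
    Primrec (treeFormula τ : Input d k → TreeFormula (Fin r) (Fin m × Bool)) := by
  have hi : Primrec fun t : (Input d k × Fin m) × Word d => t.1.2 := Primrec.snd.comp .fst
  have hrun := τ.primrec_run.comp hi .snd
  have h₀ : Primrec fun t : (Input d k × Fin m) × Word d =>
      (([], (t.1.2, true)) : TreeVar (Fin r) (Fin m × Bool)) :=
    .pair (.const []) (.pair hi (.const true))
  have h₁ : Primrec fun t : (Input d k × Fin m) × Word d =>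
      (((τ.run t.1.2 t.2).1, ((τ.run t.1.2 t.2).2, true)) : TreeVar (Fin r) (Fin m × Bool)) :=
    .pair (Primrec.fst.comp hrun) (.pair (Primrec.snd.comp hrun) (.const true))
  have hclause : ∀ {u v : (Input d k × Fin m) × Word d → TreeVar (Fin r) (Fin m × Bool)},
      Primrec u → Primrec v → Primrec fun t => [(false, u t), (true, v t)] := fun hu hv =>
    Primrec.list_cons.comp (.pair (.const false) hu)
      (Primrec.list_cons.comp (.pair (.const true) hv) (.const []))
  have hclosure : Primrec₂ fun (t : Input d k × Fin m) (w : Word d) => closureClauses τ t.2 w :=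
    Primrec.list_cons.comp (hclause h₀ h₁)
      (Primrec.list_cons.comp (hclause h₁ h₀) (.const []))
  have hguard : Primrec₂ fun (t : Input d k × Fin m) (c : Fin k → Literal (Word d)) =>
      guardedClause τ t.2 c := by
    have hi : Primrec fun t : (Input d k × Fin m) × (Fin k → Literal (Word d)) => t.1.2 :=
      Primrec.snd.comp .fst
    refine Primrec.list_cons.comp
      (.pair (.const false) (.pair (.const []) (.pair hi (.const true))))
      (Primrec.list_ofFn fun j => ?_)
    have hc : Primrec fun t : (Input d k × Fin m) × (Fin k → Literal (Word d)) => t.2 j :=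
      Primrec.fin_app.comp .snd (.const j)
    have hrun := τ.primrec_run.comp hi (Primrec.snd.comp hc)
    exact .pair (Primrec.fst.comp hc) (.pair (Primrec.fst.comp hrun)
      (.pair (Primrec.snd.comp hrun) (.const false)))
  exact Primrec.list_flatMap (.const _) (Primrec.list_append.comp
    (Primrec.list_flatMap (Primrec.snd.comp .fst) hclosure)
    (Primrec.list_map (Primrec.fst.comp .fst) hguard))

theorem forall_mem_treeFormula {τ : Table r m d} {p : Input d k}
    {Q : List (Bool × TreeVar (Fin r) (Fin m × Bool)) → Prop} :
    (∀ cl ∈ treeFormula τ p, Q cl) ↔ ∀ i,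
      (∀ w ∈ p.2, ∀ cl ∈ closureClauses τ i w, Q cl) ∧ ∀ c ∈ p.1, Q (guardedClause τ i c) := by
  simp only [treeFormula, List.mem_flatMap, List.mem_finRange, true_and, List.mem_append,
    List.mem_map]
  constructor
  · exact fun h i => ⟨fun w hw cl hcl => h cl ⟨i, .inl ⟨w, hw, hcl⟩⟩,
      fun c hc => h _ ⟨i, .inr ⟨c, hc, rfl⟩⟩⟩
  · rintro h cl ⟨i, ⟨w, hw, hcl⟩ | ⟨c, hc, rfl⟩⟩
    exacts [(h i).1 w hw cl hcl, (h i).2 c hc]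

variable {G : Type*} [Group G]

theorem literal_value_iff {V : Type*} (α : V → Bool) (l : Literal V) :
    Literal.value α l = true ↔ α l.2 = l.1 := by
  rcases l with ⟨_ | _, v⟩ <;> simp [Literal.value]

/-- The subgroup `H` is replaced by a marking `χ` subject to local conditions only. It need not be
the indicator function of `H`: a marking that contains `1` and is invariant under right
multiplication by the generators of `H` contains `H`, and this is all that is needed. -/
theorem kSAT_iff_exists_marking {s : Fin d → G} {p : Input d k} :
    KSAT s k p ↔ ∃ α χ : G → Bool, χ 1 = true ∧
      (∀ g, ∀ w ∈ p.2, (χ g = true ↔ χ (g * w.eval s) = true)) ∧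
      ∀ g, χ g = true → ∀ c ∈ p.1, ∃ j, α (g * (c j).2.eval s) = (c j).1 := by
  classical
  simp only [KSAT, Formula.SatisfiableOver, Formula.Holds, Formula.mapVar, List.forall_mem_map,
    literal_value_iff]
  constructor
  · rintro ⟨α, hα⟩
    refine ⟨α, fun g => decide (g ∈ generated s p.2), by simp [one_mem], fun g w hw => ?_,
      fun g hg => hα g (by simpa using hg)⟩
    have hmem : w.eval s ∈ generated s p.2 := Subgroup.subset_closure ⟨w, hw, rfl⟩
    simp only [decide_eq_true_iff]
    exact (Subgroup.mul_mem_cancel_right _ hmem).symm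
  · rintro ⟨α, χ, h1, hχ, hα⟩
    refine ⟨α, fun h hh => hα h ?_⟩
    -- Invariance under right multiplication by `h` is the property that is stable under products.
    suffices H : ∀ g, χ g = true ↔ χ (g * h) = true by simpa [h1] using H 1
    induction hh using Subgroup.closure_induction with
    | mem x hx => obtain ⟨w, hw, rfl⟩ := hx; exact fun g => hχ g w hw
    | one => simp
    | mul x y _ _ hx hy => intro g; rw [hx g, hy (g * x), mul_assoc]
    | inv x _ hx => intro g; rw [hx (g * x⁻¹), inv_mul_cancel_right]

theorem kSAT_iff_treeSat {f : FreeGroup (Fin r) →* G} {t : Fin m → G} {i₀ : Fin m}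
    (h1 : t i₀ = 1) (hbij : Function.Bijective fun x : FreeGroup (Fin r) × Fin m => f x.1 * t x.2)
    {s : Fin d → G} {τ : Table r m d} (hτ : τ.Computes f t s) {p : Input d k} :
    KSAT s k p ↔ TreeSat (i₀, true) (treeFormula τ p) := by
  have hrun : ∀ x i (w : Word d),
      f (x * FreeGroup.mk (τ.run i w).1) * t (τ.run i w).2 = f x * t i * w.eval s := by
    intro x i w
    rw [map_mul, mul_assoc, hτ.run, mul_assoc]
  -- Pairs of truth values on `G` are the same as truth values on `F × (Fin m × Bool)`.
  have htrans : ∀ (α χ : G → Bool) (β : FreeGroup (Fin r) → Fin m × Bool → Bool),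
      (∀ x i, β x (i, true) = χ (f x * t i)) → (∀ x i, β x (i, false) = α (f x * t i)) →
      ((χ 1 = true ∧ (∀ g, ∀ w ∈ p.2, (χ g = true ↔ χ (g * w.eval s) = true)) ∧
        ∀ g, χ g = true → ∀ c ∈ p.1, ∃ j, α (g * (c j).2.eval s) = (c j).1) ↔
      (β 1 (i₀, true) = true ∧ ∀ x, ∀ cl ∈ treeFormula τ p,
        ∃ l ∈ cl, β (x * FreeGroup.mk l.2.1) l.2.2 = l.1)) := by
    intro α χ β hχ hα
    have hsurj : ∀ {R : G → Prop}, (∀ g, R g) ↔ ∀ x i, R (f x * t i) := fun {R} =>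
      ⟨fun h x i => h _, fun h g => by obtain ⟨y, rfl⟩ := hbij.2 g; exact h _ _⟩
    rw [hχ, map_one, one_mul, h1, hsurj, hsurj]
    simp only [forall_mem_treeFormula, closureClauses, guardedClause, List.forall_mem_cons,
      List.exists_mem_cons_iff, List.not_mem_nil, List.mem_ofFn, hχ, hα, hrun,
      ← FreeGroup.one_eq_mk, mul_one, false_and, exists_false, or_false, false_implies,
      implies_true, and_true, exists_exists_eq_and]
    simp only [← forall_and]
    refine and_congr_right fun _ => forall₂_congr fun x i => and_congr ?_ ?_
    · refine forall₂_congr fun w _ => ?_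
      cases χ (f x * t i) <;> cases χ (f x * t i * w.eval s) <;> simp
    · cases χ (f x * t i) <;> simp
  rw [kSAT_iff_exists_marking]
  constructor
  · rintro ⟨α, χ, h⟩
    let β : FreeGroup (Fin r) → Fin m × Bool → Bool := fun x c =>
      if c.2 then χ (f x * t c.1) else α (f x * t c.1)
    exact ⟨β, (htrans α χ β (fun _ _ => rfl) (fun _ _ => rfl)).1 h⟩
  · rintro ⟨β, h⟩
    let e := Equiv.ofBijective _ hbij
    have he : ∀ x i, e.symm (f x * t i) = (x, i) := fun x i => e.symm_apply_apply (x, i)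
    let γ : Bool → G → Bool := fun b g => β (e.symm g).1 ((e.symm g).2, b)
    have hγ : ∀ b x i, β x (i, b) = γ b (f x * t i) := fun b x i => by simp only [γ, he]
    exact ⟨γ false, γ true, (htrans _ _ β (hγ true) (hγ false)).2 h⟩

end Encoding

end GroupSAT

theorem mainTheorem9 {G : Type*} [Group G] (hfg : Group.FG G) (hG : IsVirtuallyFree G)
    (k : ℕ) (hk : 1 < k) : GroupSAT.KSATDecidable k G := by
  intro d s _
  obtain ⟨r, m, f, t, i₀, h1, hbij⟩ := GroupSAT.exists_free_transversal hfg hG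
  obtain ⟨τ, hτ⟩ := GroupSAT.Table.exists_computes hbij.2 s
  exact PrimrecPred.computablePred (((GroupSAT.primrecPred_treeSat (i₀, true)).comp
    (GroupSAT.primrec_treeFormula τ)).of_eq fun _ => (GroupSAT.kSAT_iff_treeSat h1 hbij hτ).symm)
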